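/- Let $n\ge 0$, let $\gamma$ be the standard Gaussian measure on $\mathbb{R}^n$, and let $f:\mathbb{R}^n\to\mathbb{R}$ be a twice differentiable function such that $d\nu=e^f\,d\gamma$ is a probability measure. Let $$D_{\mathrm{KL}}(\nu\,\|\,\gamma)=\int_{\mathbb{R}^n} f\,d\nu,\qquad \mathcal{I}(\nu)=\int_{\mathbb{R}^n}|\nabla f|^2\,d\nu$$ be the Kullback-Leibler divergence and the Fisher information of $\nu$ with respect to $\gamma$, let $M=-\inf_{x\in\mathbb{R}^n}\Delta f(x)$, and let $$\mathcal{D}(\nu)=\int_{\mathbb{R}^n}\sup_{t\in K}\langle y,t\rangle\,d\gamma(y)$$ be the Gaussian width of the set $K=\{\nabla f(x):x\in\mathbb{R}^n\}$. Assume that $D_{\mathrm{KL}}(\nu\,\|\,\gamma)$, $\mathcal{I}(\nu)$ and $M$ are finite, and that $y\mapsto\sup_{t\in K}\langle y,t\rangle$ is integrable with respect to $\gamma$. Then $$\tfrac12\,\mathcal{I}(\nu)\;\le\; D_{\mathrm{KL}}(\nu\,\|\,\gamma)+M+\mathcal{D}(\nu).$$ -/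

import Mathlib

open MeasureTheory ProbabilityTheory InformationTheory
open scoped ENNReal Gradient Laplacian

noncomputable section

/-- The standard Gaussian measure `γ` on `ℝⁿ`. -/
abbrev gaussian (n : ℕ) : Measure (EuclideanSpace ℝ (Fin n)) :=
  stdGaussian (EuclideanSpace ℝ (Fin n))

/-- The measure `ν` given by `dν = e^f dγ`. -/
def gaussianDensityMeasure {n : ℕ} (f : EuclideanSpace ℝ (Fin n) → ℝ) :
    Measure (EuclideanSpace ℝ (Fin n)) :=
  (gaussian n).withDensity fun x => ENNReal.ofReal (Real.exp (f x))

/-- The Fisher information `I(ν) = ∫ |∇f|² dν` of `dν = e^f dγ` with respect to `γ`. -/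
def fisherInfo {n : ℕ} (f : EuclideanSpace ℝ (Fin n) → ℝ) : ℝ :=
  ∫ x, ‖∇ f x‖ ^ 2 ∂(gaussianDensityMeasure f)

/-- The support function `y ↦ sup_{t ∈ K} ⟨y, t⟩` of `K`; it is the true supremum at the points `y`
where `K` is nonempty and the set of values `⟨y, t⟩` is bounded above. -/
def supportFun {n : ℕ} (K : Set (EuclideanSpace ℝ (Fin n))) (y : EuclideanSpace ℝ (Fin n)) : ℝ :=
  sSup ((fun t => inner ℝ y t) '' K)

/-- `y ↦ sup_{t ∈ K} ⟨y, t⟩` is integrable with respect to `γ`. In particular the supremum is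
finite for almost every `y`, which has to be said since a real-valued `sSup` is `0` on sets that are
unbounded above. -/
def HasGaussianWidth {n : ℕ} (K : Set (EuclideanSpace ℝ (Fin n))) : Prop :=
  (∀ᵐ y ∂(gaussian n), BddAbove ((fun t => inner ℝ y t) '' K)) ∧
    Integrable (supportFun K) (gaussian n)

/-- The Gaussian width `GW(K) = ∫ sup_{t ∈ K} ⟨y, t⟩ dγ(y)`. -/
def gaussianWidth {n : ℕ} (K : Set (EuclideanSpace ℝ (Fin n))) : ℝ :=
  ∫ y, supportFun K y ∂(gaussian n)

end

/-! Put k(x) = ⟨x, ∇f⟩ − |∇f|²/2. The field e^{f−|x|²/2} ∇f has divergence e^{f−|x|²/2} (Δf + |∇f|²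
− ⟨x, ∇f⟩), so integration by parts and Δf ≥ −M give, formally, I(ν)/2 ≤ M + ∫ k dν. The Gibbs
variational principle bounds ∫ k dν by D_KL + log ∫ e^k dγ, and it remains to see that ∫ e^k dγ ≤
e^{D(ν)}. Now k(x) ≤ sup_{t ∈ K} (⟨x, t⟩ − |t|²/2), and by ⟨x − y, t⟩ ≤ |x − y|²/2 + |t|²/2 this is
at most sup_{t ∈ K} ⟨y, t⟩ + |x − y|²/2 for every y. The dual form of Talagrand's inequality,
`dualTransportInequality_gaussian`, turns this into the bound needed. It is proved by monotone
transport in dimension one and then tensorized. Two points need care. Second derivatives of f need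
not be continuous or locally integrable, so integration by parts rests on a gauge-integral
divergence theorem (`integral_nonpos_of_le_divergence`). Nor is k known in advance to be
ν-integrable, so `exists_integrable_majorant` replaces it by an integrable upper bound before the
cutoffs are removed. -/

open Filter Set Topology
open scoped NNReal

/-! ### Monotone transport on the line -/

section MonotoneTransport

variable {φ ψ : ℝ → ℝ}

lemma setIntegral_Iic_eq_add_intervalIntegral (hφi : Integrable φ) (x : ℝ) :
    ∫ t in Iic x, φ t = (∫ t in Iic (0 : ℝ), φ t) + ∫ t in (0 : ℝ)..x, φ t := by
  rw [← intervalIntegral.integral_Iic_sub_Iic hφi.integrableOn hφi.integrableOn]; ring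

lemma hasStrictDerivAt_setIntegral_Iic (hφ : Continuous φ) (hφi : Integrable φ) (x : ℝ) :
    HasStrictDerivAt (fun x => ∫ t in Iic x, φ t) (φ x) x := by
  have : (fun x => ∫ t in Iic x, φ t) =
      fun x => (∫ t in Iic (0 : ℝ), φ t) + ∫ t in (0 : ℝ)..x, φ t :=
    funext (setIntegral_Iic_eq_add_intervalIntegral hφi)
  rw [this]
  exact (intervalIntegral.integral_hasStrictDerivAt_right hφi.intervalIntegrable
    hφ.stronglyMeasurable.stronglyMeasurableAtFilter hφ.continuousAt).const_add _

lemma strictMono_setIntegral_Iic (hφ : Continuous φ) (hφi : Integrable φ) (hφ0 : ∀ x, 0 < φ x) :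
    StrictMono fun x => ∫ t in Iic x, φ t := by
  refine strictMono_of_deriv_pos fun x => ?_
  rw [(hasStrictDerivAt_setIntegral_Iic hφ hφi x).hasDerivAt.deriv]
  exact hφ0 x

lemma range_setIntegral_Iic (hφ : Continuous φ) (hφi : Integrable φ) (hφ0 : ∀ x, 0 < φ x)
    (hφ1 : ∫ x, φ x = 1) : range (fun x => ∫ t in Iic x, φ t) = Ioo 0 1 := by
  have hm := strictMono_setIntegral_Iic hφ hφi hφ0
  have hc : Continuous fun x => ∫ t in Iic x, φ t := continuous_iff_continuousAt.2 fun x =>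
    (hasStrictDerivAt_setIntegral_Iic hφ hφi x).hasDerivAt.continuousAt
  have htop : Tendsto (fun x => ∫ t in Iic x, φ t) atTop (𝓝 1) := hφ1 ▸
    (aecover_Iic tendsto_id).integral_tendsto_of_countably_generated hφi
  have hbot : Tendsto (fun x => ∫ t in Iic x, φ t) atBot (𝓝 0) := by
    have h := (aecover_Ioi (μ := volume) tendsto_id).integral_tendsto_of_countably_generated hφi
    have h2 := h.const_sub (∫ x, φ x)
    rw [sub_self] at h2
    refine h2.congr fun x => ?_
    rw [← intervalIntegral.integral_Iic_add_Ioi (b := x) hφi.integrableOn hφi.integrableOn]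
    simp
  ext u
  constructor
  · rintro ⟨x, rfl⟩
    exact ⟨(hm.monotone.le_of_tendsto hbot (x - 1)).trans_lt (hm (by linarith)),
      (hm (show x < x + 1 by linarith)).trans_le (hm.monotone.ge_of_tendsto htop (x + 1))⟩
  · rintro ⟨h0, h1⟩
    exact mem_range_of_exists_le_of_exists_ge hc
      ((hbot.eventually (gt_mem_nhds h0)).exists.imp fun _ h => h.le)
      ((htop.eventually (lt_mem_nhds h1)).exists.imp fun _ h => h.le)

/-- The monotone rearrangement between two positive continuous probability densities on `ℝ`. -/
theorem exists_monotone_transport (hφ : Continuous φ) (hφi : Integrable φ) (hφ0 : ∀ x, 0 < φ x)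
    (hφ1 : ∫ x, φ x = 1) (hψ : Continuous ψ) (hψi : Integrable ψ) (hψ0 : ∀ x, 0 < ψ x)
    (hψ1 : ∫ x, ψ x = 1) :
    ∃ T : ℝ → ℝ, StrictMono T ∧ ∀ y, HasDerivAt T ((ψ (T y))⁻¹ * φ y) y := by
  have hr := (range_setIntegral_Iic hφ hφi hφ0 hφ1).trans
    (range_setIntegral_Iic hψ hψi hψ0 hψ1).symm
  have hmφ := strictMono_setIntegral_Iic hφ hφi hφ0
  have hmψ := strictMono_setIntegral_Iic hψ hψi hψ0
  have hex : ∀ y, ∃ x, ∫ t in Iic x, ψ t = ∫ t in Iic y, φ t := fun y => by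
    have : (∫ t in Iic y, φ t) ∈ range (fun x => ∫ t in Iic x, φ t) := ⟨y, rfl⟩
    rwa [hr] at this
  choose T hT using hex
  have hTm : StrictMono T := fun a b hab => by
    rw [← hmψ.lt_iff_lt]
    simpa only [hT] using hmφ hab
  have hTs : Function.Surjective T := fun x => by
    have : (∫ t in Iic x, ψ t) ∈ range (fun x => ∫ t in Iic x, ψ t) := ⟨x, rfl⟩
    rw [← hr] at this
    obtain ⟨y, hy⟩ := this
    exact ⟨y, hmψ.injective ((hT y).trans hy)⟩
  -- Continuity keeps T y' in the neighbourhood of T y where the local inverse of the ψ-distribution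
  -- function is valid; T is then locally that inverse composed with the φ-distribution function.
  have hTc : Continuous T := hTm.monotone.continuous_of_surjective hTs
  refine ⟨T, hTm, fun y => ?_⟩
  have hs := hasStrictDerivAt_setIntegral_Iic hψ hψi (T y)
  have hne := (hψ0 (T y)).ne'
  have hinv := (hs.to_localInverse hne).hasDerivAt
  have hev := (hs.hasStrictFDerivAt_equiv hne).eventually_left_inverse
  have h1 : ∀ᶠ y' in 𝓝 y, hs.localInverse _ _ _ hne (∫ t in Iic y', φ t) = T y' := by
    filter_upwards [hTc.continuousAt.eventually hev] with y' hy'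
    rw [← hT y']
    exact hy'
  simp only [hT y] at hinv
  exact (hinv.comp y (hasStrictDerivAt_setIntegral_Iic hφ hφi y).hasDerivAt).congr_of_eventuallyEq
    (h1.mono fun _ h => h.symm)

/-- Change of variables x = T y, using T'(y) ψ(T y) = φ(y). -/
lemma integrable_transport_mul {T : ℝ → ℝ} (hTm : StrictMono T)
    (hψ0 : ∀ x, 0 < ψ x) (hφ0 : ∀ x, 0 < φ x)
    (hTd : ∀ y, HasDerivAt T ((ψ (T y))⁻¹ * φ y) y) (hi : Integrable fun x => x * ψ x) :
    Integrable fun y => T y * φ y := by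
  have h := (integrableOn_image_iff_integrableOn_abs_deriv_smul MeasurableSet.univ
    (fun y _ => (hTd y).hasDerivWithinAt) hTm.injective.injOn (fun x => x * ψ x)).1
    hi.integrableOn
  rw [integrableOn_univ] at h
  refine h.congr (ae_of_all _ fun y => ?_)
  simp only [smul_eq_mul]
  rw [abs_of_pos (mul_pos (inv_pos.2 (hψ0 _)) (hφ0 _))]
  have := (hψ0 (T y)).ne'
  field_simp

end MonotoneTransport

/-- An integrable function on `ℝ` takes small values at `R` and `-R` for arbitrarily large `R`. -/
lemma Integrable.exists_sub_neg_lt {F : ℝ → ℝ} (hF : Integrable F) {ε : ℝ} (hε : 0 < ε) (R₀ : ℝ) :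
    ∃ R ≥ R₀, F R - F (-R) < ε := by
  by_contra! hcon
  have hi : Integrable fun R => F R - F (-R) := hF.sub hF.comp_neg
  have hc : IntegrableOn (fun _ : ℝ => ε) (Ici R₀) := by
    refine Integrable.mono' hi.integrableOn (by fun_prop) ?_
    refine (ae_restrict_iff' measurableSet_Ici).2 (ae_of_all _ fun R hR => ?_)
    rw [Real.norm_of_nonneg hε.le]
    exact hcon R hR
  rw [integrableOn_const_iff] at hc
  simp [hε.ne'] at hc

/-! ### Talagrand's inequality in dimension one -/

lemma hasDerivAt_gaussianPDFReal_std (x : ℝ) :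
    HasDerivAt (gaussianPDFReal 0 1) (-x * gaussianPDFReal 0 1 x) x := by
  have h : HasDerivAt (fun x : ℝ => (√(2 * Real.pi * (1 : ℝ≥0)))⁻¹ *
      Real.exp (-(x - 0) ^ 2 / (2 * (1 : ℝ≥0)))) ((√(2 * Real.pi * (1 : ℝ≥0)))⁻¹ *
      (Real.exp (-(x - 0) ^ 2 / (2 * (1 : ℝ≥0))) *
        (-((2 : ℕ) * (x - 0) ^ (2 - 1) * 1) / (2 * (1 : ℝ≥0))))) x :=
    ((((hasDerivAt_id x).sub_const 0).pow 2).fun_neg.div_const _).exp.const_mul _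
  refine h.congr_deriv ?_
  simp only [gaussianPDFReal]
  push_cast
  ring

lemma integrable_gaussianReal_iff {u : ℝ → ℝ} :
    Integrable u (gaussianReal 0 1) ↔ Integrable fun x => u x * gaussianPDFReal 0 1 x := by
  rw [gaussianReal_of_var_ne_zero _ one_ne_zero,
    integrable_withDensity_iff (measurable_gaussianPDF 0 1) (ae_of_all _ fun _ => by
      simp [gaussianPDF])]
  simp [gaussianPDF, gaussianPDFReal_nonneg]

lemma integral_gaussianReal_std (u : ℝ → ℝ) :
    ∫ x, u x ∂(gaussianReal 0 1) = ∫ x, u x * gaussianPDFReal 0 1 x := by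
  rw [integral_gaussianReal_eq_integral_smul one_ne_zero]
  simp [mul_comm]

/-- Dual form of Talagrand's transport inequality for the standard Gaussian measure on `ℝ`. -/
theorem integral_exp_le_exp_integral_gaussianReal {g h : ℝ → ℝ} (hg : Continuous g)
    (hgi : Integrable (fun x => Real.exp (g x)) (gaussianReal 0 1))
    (hgi' : Integrable (fun x => x * Real.exp (g x)) (gaussianReal 0 1))
    (hhi : Integrable h (gaussianReal 0 1)) (hgh : ∀ x y, g x ≤ h y + (x - y) ^ 2 / 2) :
    ∫ x, Real.exp (g x) ∂(gaussianReal 0 1) ≤ Real.exp (∫ x, h x ∂(gaussianReal 0 1)) := by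
  set φ := gaussianPDFReal 0 1 with hφdef
  set Z := ∫ x, Real.exp (g x) ∂(gaussianReal 0 1) with hZdef
  have hφd : ∀ x, HasDerivAt φ (-x * φ x) x := hasDerivAt_gaussianPDFReal_std
  have hφ0 : ∀ x, 0 < φ x := fun x => gaussianPDFReal_pos 0 1 x one_ne_zero
  have hφc : Continuous φ := continuous_iff_continuousAt.2 fun x => (hφd x).continuousAt
  have hφi : Integrable φ := integrable_gaussianPDFReal 0 1
  have hφ1 : ∫ x, φ x = 1 := integral_gaussianPDFReal_eq_one 0 one_ne_zero
  have hZ : 0 < Z := integral_exp_pos hgi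
  rw [← Real.log_le_iff_le_exp hZ]
  set ψ : ℝ → ℝ := fun x => Real.exp (g x) * φ x / Z with hψdef
  have hψ0 : ∀ x, 0 < ψ x := fun x => by have := hφ0 x; positivity
  have hψc : Continuous ψ := by fun_prop
  have hψi : Integrable ψ := (integrable_gaussianReal_iff.1 hgi).div_const Z
  have hψ1 : ∫ x, ψ x = 1 := by
    rw [integral_div, ← integral_gaussianReal_std, div_self hZ.ne']
  obtain ⟨T, hTm, hTd⟩ := exists_monotone_transport hφc hφi hφ0 hφ1 hψc hψi hψ0 hψ1
  have hTi : Integrable fun y => T y * φ y := by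
    refine integrable_transport_mul hTm hψ0 hφ0 hTd ?_
    refine ((integrable_gaussianReal_iff.1 hgi').div_const Z).congr (ae_of_all _ fun x => ?_)
    simp only [hψdef, hφdef]; ring
  have hidi : Integrable fun y => y * φ y := integrable_gaussianReal_iff.1
    (IsGaussian.integrable_id (μ := gaussianReal 0 1))
  have hFi : Integrable fun y => (T y - y) * φ y := by
    refine (hTi.sub hidi).congr (ae_of_all _ fun x => ?_)
    simp only [Pi.sub_apply]; ring
  -- By φ' = −yφ, this derivative is exactly the upper bound for (log Z − h) φ that the transport
  -- argument yields.
  have hFd : ∀ y, HasDerivAt (fun y => (T y - y) * φ y)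
      (((ψ (T y))⁻¹ * φ y - 1 - y * T y + y ^ 2) * φ y) y := fun y => by
    refine (((hTd y).sub (hasDerivAt_id y)).mul (hφd y)).congr_deriv ?_
    simp only [Pi.sub_apply, id]; ring
  have hφe : ∀ x, Real.log (φ x) = Real.log (φ 0) - x ^ 2 / 2 := fun x => by
    have e : ∀ x, φ x = (√(2 * Real.pi))⁻¹ * Real.exp (-x ^ 2 / 2) := fun x => by
      simp [hφdef, gaussianPDFReal]
    have hp : (√(2 * Real.pi))⁻¹ ≠ 0 := by positivity
    rw [e, e, Real.log_mul hp (Real.exp_ne_zero _), Real.log_mul hp (Real.exp_ne_zero _),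
      Real.log_exp, Real.log_exp]
    ring
  have hineq : ∀ y, (Real.log Z - h y) * φ y ≤
      ((ψ (T y))⁻¹ * φ y - 1 - y * T y + y ^ 2) * φ y := fun y => by
    refine mul_le_mul_of_nonneg_right ?_ (hφ0 y).le
    -- Here T' = φ(y)/ψ(T y), and log T' ≤ T' − 1. Expanding log T' as log Z − g(T y) + (T y)²/2 −
    -- y²/2 and bounding g(T y) by h(y) + (T y − y)²/2 leaves the claim.
    have h1 := Real.log_le_sub_one_of_pos (mul_pos (inv_pos.2 (hψ0 (T y))) (hφ0 y))
    have h2 := hgh (T y) y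
    rw [Real.log_mul (inv_pos.2 (hψ0 (T y))).ne' (hφ0 y).ne', Real.log_inv, hφe y] at h1
    simp only [hψdef] at h1 ⊢
    rw [Real.log_div (mul_pos (Real.exp_pos _) (hφ0 _)).ne' hZ.ne',
      Real.log_mul (Real.exp_ne_zero _) (hφ0 _).ne', Real.log_exp, hφe (T y)] at h1
    nlinarith
  have hli : Integrable fun y => (Real.log Z - h y) * φ y :=
    integrable_gaussianReal_iff.1 ((integrable_const _).sub hhi)
  have hlim := intervalIntegral_tendsto_integral hli tendsto_neg_atTop_atBot tendsto_id
  rw [← integral_gaussianReal_std, integral_sub (integrable_const _) hhi, integral_const,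
    probReal_univ, one_smul] at hlim
  -- If log Z exceeded ∫ h dγ, the integrals over [−R, R] would eventually exceed half the gap,
  -- while the boundary terms of (T y − y) φ drop below it for some large R.
  by_contra! hcon
  have hε : 0 < (Real.log Z - ∫ x, h x ∂(gaussianReal 0 1)) / 2 := by linarith
  obtain ⟨R₀, hR₀⟩ := eventually_atTop.1
    ((hlim.eventually (lt_mem_nhds (show (Real.log Z - ∫ x, h x ∂(gaussianReal 0 1)) / 2 < _ by
      linarith))))
  obtain ⟨R, hR, hlt⟩ := Integrable.exists_sub_neg_lt hFi hε (max R₀ 0)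
  have hR0 : 0 ≤ R := (le_max_right _ _).trans hR
  have h3 := intervalIntegral.integral_le_sub_of_hasDeriv_right_of_le (a := -R) (b := R)
    (by linarith) (fun x _ => (hFd x).continuousAt.continuousWithinAt)
    (fun x _ => (hFd x).hasDerivWithinAt) hli.integrableOn (fun x _ => hineq x)
  have h4 := hR₀ R ((le_max_left _ _).trans hR)
  simp only [id] at h4
  linarith

lemma lipschitzWith_abs_le_add {E : Type*} [NormedAddCommGroup E] {K : ℝ≥0} {g : E → ℝ}
    (hg : LipschitzWith K g) (x : E) :
    |g x| ≤ |g 0| + K * ‖x‖ := by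
  have h := hg.dist_le_mul x 0
  rw [dist_zero_right, Real.dist_eq] at h
  have h2 := abs_sub_abs_le_abs_sub (g x) (g 0)
  linarith

/-! ### Dual transport inequalities under linear maps and products -/

section DualTransport

variable {E F : Type*} [NormedAddCommGroup E] [MeasurableSpace E] [BorelSpace E]
  [NormedAddCommGroup F] [MeasurableSpace F] [BorelSpace F]

/-- `μ` has all exponential moments of the norm. -/
def HasExpMoments (μ : Measure E) : Prop :=
  ∀ a : ℝ, Integrable (fun x => Real.exp (a * ‖x‖)) μ

/-- The dual (Bobkov–Götze) form of the transport-entropy inequality with cost `c`. -/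
def DualTransportInequality (μ : Measure E) (c : E → E → ℝ) : Prop :=
  ∀ (K : ℝ≥0) (g h : E → ℝ), LipschitzWith K g → LipschitzWith K h →
    (∀ x y, g x ≤ h y + c x y) → ∫ x, Real.exp (g x) ∂μ ≤ Real.exp (∫ x, h x ∂μ)

lemma HasExpMoments.integrable_exp [SecondCountableTopology E] {μ : Measure E}
    (hμ : HasExpMoments μ) {K : ℝ≥0} {g : E → ℝ} (hg : LipschitzWith K g) :
    Integrable (fun x => Real.exp (g x)) μ := by
  refine ((hμ K).const_mul (Real.exp |g 0|)).mono'
    (Real.continuous_exp.comp hg.continuous).aestronglyMeasurable (ae_of_all _ fun x => ?_)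
  rw [Real.norm_of_nonneg (Real.exp_pos _).le, ← Real.exp_add]
  exact Real.exp_le_exp.2 ((le_abs_self _).trans (lipschitzWith_abs_le_add hg x))

lemma HasExpMoments.integrable_norm_mul_exp [SecondCountableTopology E] {μ : Measure E}
    (hμ : HasExpMoments μ) {K : ℝ≥0} {g : E → ℝ} (hg : LipschitzWith K g) :
    Integrable (fun x => ‖x‖ * Real.exp (g x)) μ := by
  refine ((hμ (1 + K)).const_mul (Real.exp |g 0|)).mono'
    (continuous_norm.mul (Real.continuous_exp.comp hg.continuous)).aestronglyMeasurable
    (ae_of_all _ fun x => ?_)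
  rw [Real.norm_of_nonneg (by positivity), ← Real.exp_add]
  have h1 : ‖x‖ ≤ Real.exp ‖x‖ := by linarith [Real.add_one_le_exp ‖x‖]
  have h2 := Real.exp_le_exp.2 ((le_abs_self _).trans (lipschitzWith_abs_le_add hg x))
  calc ‖x‖ * Real.exp (g x) ≤ Real.exp ‖x‖ * Real.exp (|g 0| + K * ‖x‖) := by gcongr
    _ = Real.exp (|g 0| + (1 + K) * ‖x‖) := by rw [← Real.exp_add]; ring_nf

lemma HasExpMoments.integrable [SecondCountableTopology E] {μ : Measure E} [IsFiniteMeasure μ]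
    (hμ : HasExpMoments μ) {K : ℝ≥0} {h : E → ℝ} (hh : LipschitzWith K h) : Integrable h μ := by
  refine ((integrable_const |h 0|).add ((hμ 1).const_mul K)).mono'
    hh.continuous.aestronglyMeasurable (ae_of_all _ fun x => ?_)
  refine (lipschitzWith_abs_le_add hh x).trans ?_
  have h1 : ‖x‖ ≤ Real.exp (1 * ‖x‖) := by rw [one_mul]; linarith [Real.add_one_le_exp ‖x‖]
  simp only [Pi.add_apply]
  gcongr

lemma hasExpMoments_of_isGaussian [NormedSpace ℝ E] [SecondCountableTopology E] [CompleteSpace E]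
    (μ : Measure E) [IsGaussian μ] : HasExpMoments μ := fun a => by
  obtain ⟨C, hC, hi⟩ := IsGaussian.exists_integrable_exp_sq μ
  refine (hi.const_mul (Real.exp (a ^ 2 / (4 * C)))).mono' (by fun_prop)
    (ae_of_all _ fun x => ?_)
  rw [Real.norm_of_nonneg (Real.exp_pos _).le, ← Real.exp_add]
  refine Real.exp_le_exp.2 ?_
  have : a ^ 2 / (4 * C) + C * ‖x‖ ^ 2 - a * ‖x‖ = (a - 2 * C * ‖x‖) ^ 2 / (4 * C) := by
    field_simp; ring
  have h2 : 0 ≤ (a - 2 * C * ‖x‖) ^ 2 / (4 * C) := by positivity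
  linarith

lemma HasExpMoments.prod {μ : Measure E} {ν : Measure F} [SFinite μ] [SFinite ν]
    [SecondCountableTopology E] [SecondCountableTopology F]
    (hμ : HasExpMoments μ) (hν : HasExpMoments ν) : HasExpMoments (μ.prod ν) := fun a => by
  refine ((hμ |a|).mul_prod (hν |a|)).mono' (by fun_prop) (ae_of_all _ fun p => ?_)
  rw [Real.norm_of_nonneg (Real.exp_pos _).le, ← Real.exp_add, ← mul_add]
  refine Real.exp_le_exp.2 ?_
  have : ‖p‖ ≤ ‖p.1‖ + ‖p.2‖ := by
    rw [Prod.norm_def]; exact max_le_add_of_nonneg (norm_nonneg _) (norm_nonneg _)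
  gcongr
  exact le_abs_self a

lemma HasExpMoments.map [NormedSpace ℝ E] [NormedSpace ℝ F] [SecondCountableTopology F]
    {μ : Measure E} (hμ : HasExpMoments μ)
    (T : E →L[ℝ] F) : HasExpMoments (μ.map T) := fun a => by
  rw [integrable_map_measure (by fun_prop) (by fun_prop)]
  refine (hμ (|a| * ‖T‖)).mono' (by fun_prop) (ae_of_all _ fun p => ?_)
  simp only [Function.comp_apply]
  rw [Real.norm_of_nonneg (Real.exp_pos _).le, mul_assoc]
  refine Real.exp_le_exp.2 ?_
  have := T.le_opNorm p
  gcongr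
  exact le_abs_self a

lemma DualTransportInequality.map [NormedSpace ℝ E] [NormedSpace ℝ F] [SecondCountableTopology F]
    {μ : Measure E} {c : E → E → ℝ} (hμ : DualTransportInequality μ c)
    (T : E →L[ℝ] F) {d : F → F → ℝ} (hd : ∀ x y, d (T x) (T y) ≤ c x y) :
    DualTransportInequality (μ.map T) d := fun K g h hg hh hgh => by
  have hge : Continuous fun x => Real.exp (g x) := Real.continuous_exp.comp hg.continuous
  rw [integral_map (by fun_prop) hge.aestronglyMeasurable,
    integral_map (by fun_prop) hh.continuous.aestronglyMeasurable]
  exact hμ (K * ‖T‖₊) (g ∘ T) (h ∘ T) (hg.comp T.lipschitz) (hh.comp T.lipschitz)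
    fun x y => (hgh _ _).trans (add_le_add_right (hd x y) _)

/-- Tensorization of the dual transport inequality. -/
theorem DualTransportInequality.prod {μ : Measure E} {ν : Measure F} [IsProbabilityMeasure μ]
    [IsProbabilityMeasure ν] [SecondCountableTopology E] [SecondCountableTopology F]
    {c : E → E → ℝ} {d : F → F → ℝ} (hμ : HasExpMoments μ) (hν : HasExpMoments ν)
    (hc : DualTransportInequality μ c) (hd : DualTransportInequality ν d) :
    DualTransportInequality (μ.prod ν) fun p q => c p.1 q.1 + d p.2 q.2 := by
  intro K g h hg hh hgh
  have hμν := hμ.prod hν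
  have hl : ∀ {u : E × F → ℝ}, LipschitzWith K u → ∀ y, LipschitzWith K fun x => u (x, y) :=
    fun hu y => by simpa [Function.comp_def] using hu.comp (LipschitzWith.prodMk_right y)
  have hr : ∀ {u : E × F → ℝ}, LipschitzWith K u → ∀ x y y',
      u (x, y) ≤ u (x, y') + K * dist y y' := fun {u} hu x y y' => by
    have h1 := hu.dist_le_mul (x, y) (x, y')
    rw [Real.dist_eq, Prod.dist_eq] at h1
    simp only [dist_self, dist_nonneg, max_eq_right] at h1
    linarith [le_abs_self (u (x, y) - u (x, y'))]
  have hgi : ∀ y, Integrable (fun x => Real.exp (g (x, y))) μ := fun y =>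
    hμ.integrable_exp (hl hg y)
  have hhi : ∀ y, Integrable (fun x => h (x, y)) μ := fun y => hμ.integrable (hl hh y)
  have hpos : ∀ y, 0 < ∫ x, Real.exp (g (x, y)) ∂μ := fun y => integral_exp_pos (hgi y)
  -- Integrating out x gives log ∫ e^{g(x, y)} dμ and ∫ h(x, y) dμ. Both remain K-Lipschitz, and the
  -- inequality for μ makes them an admissible pair for ν.
  have hg1 : LipschitzWith K fun y => Real.log (∫ x, Real.exp (g (x, y)) ∂μ) := by
    refine LipschitzWith.of_le_add_mul K fun y y' => ?_
    rw [← Real.log_exp (K * dist y y'), ← Real.log_mul (hpos y').ne' (Real.exp_ne_zero _)]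
    refine Real.log_le_log (hpos y) ?_
    rw [← integral_mul_const]
    refine integral_mono (hgi y) ((hgi y').mul_const _) fun x => ?_
    simp only
    rw [← Real.exp_add]
    exact Real.exp_le_exp.2 (hr hg x y y')
  have hh1 : LipschitzWith K fun y => ∫ x, h (x, y) ∂μ := by
    refine LipschitzWith.of_le_add_mul K fun y y' => ?_
    calc ∫ x, h (x, y) ∂μ ≤ ∫ x, (h (x, y') + K * dist y y') ∂μ :=
          integral_mono (hhi y) ((hhi y').add (integrable_const _)) fun x => hr hh x y y'
      _ = _ := by rw [integral_add (hhi y') (integrable_const _)]; simp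
  have key : ∀ y y', Real.log (∫ x, Real.exp (g (x, y)) ∂μ) ≤ ∫ x, h (x, y') ∂μ + d y y' := by
    intro y y'
    rw [Real.log_le_iff_le_exp (hpos y)]
    have h1 : LipschitzWith K fun x => h (x, y') + d y y' := by
      simpa using (hl hh y').add (LipschitzWith.const (d y y'))
    have := hc K _ _ (hl hg y) h1 fun x x' => by
      have := hgh (x, y) (x', y'); simp only at this ⊢; linarith
    rwa [integral_add (hhi y') (integrable_const _), integral_const, probReal_univ, one_smul]
      at this
  have := hd K _ _ hg1 hh1 key
  rw [integral_prod_symm _ (hμν.integrable_exp hg), integral_prod_symm _ (hμν.integrable hh)]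
  simpa only [Real.exp_log (hpos _)] using this

end DualTransport

/-! ### Talagrand's inequality for the Gaussian measure in every dimension -/

lemma dualTransportInequality_gaussianReal :
    DualTransportInequality (gaussianReal 0 1) fun x y => (x - y) ^ 2 / 2 :=
  fun K g h hg hh hgh => by
  have hm := hasExpMoments_of_isGaussian (gaussianReal 0 1)
  refine integral_exp_le_exp_integral_gaussianReal hg.continuous (hm.integrable_exp hg) ?_
    (hm.integrable hh) hgh
  refine (hm.integrable_norm_mul_exp hg).mono
    (continuous_id.mul (Real.continuous_exp.comp hg.continuous)).aestronglyMeasurable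
    (ae_of_all _ fun x => ?_)
  simp

lemma dualTransportInequality_pi_gaussianReal (n : ℕ) :
    HasExpMoments (Measure.pi fun _ : Fin n => gaussianReal 0 1) ∧
    DualTransportInequality (Measure.pi fun _ : Fin n => gaussianReal 0 1)
      fun x y => ∑ i, (x i - y i) ^ 2 / 2 := by
  induction n with
  | zero =>
    refine ⟨fun a => ?_, fun K g h _ _ hgh => ?_⟩
    · refine (integrable_const (Real.exp (a * ‖(0 : Fin 0 → ℝ)‖))).congr (ae_of_all _ fun x => ?_)
      rw [Subsingleton.elim x 0]
    · have h0 := hgh default default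
      simp only [Fin.sum_univ_zero, add_zero] at h0
      rw [integral_unique, integral_unique, probReal_univ, one_smul, one_smul]
      refine Real.exp_le_exp.2 ?_
      convert h0
  | succ n ih =>
    obtain ⟨ih1, ih2⟩ := ih
    let T : ℝ × (Fin n → ℝ) →L[ℝ] (Fin (n + 1) → ℝ) := ContinuousLinearMap.pi
      (Fin.cons (ContinuousLinearMap.fst ℝ ℝ (Fin n → ℝ))
        fun i => (ContinuousLinearMap.proj i).comp (ContinuousLinearMap.snd ℝ ℝ (Fin n → ℝ)))
    have hT0 : ∀ p, T p 0 = p.1 := fun p => rfl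
    have hTs : ∀ p i, T p (Fin.succ i) = p.2 i := fun p i => rfl
    -- The measurable equivalence carries the product measure; its linear form T carries the
    -- Lipschitz bounds.
    have hTe : ⇑T = (MeasurableEquiv.piFinSuccAbove (fun _ : Fin (n + 1) => ℝ) 0).symm := by
      ext p i
      refine Fin.cases ?_ (fun i => ?_) i
      · rw [hT0]; simp [MeasurableEquiv.piFinSuccAbove]
      · rw [hTs]; simp [MeasurableEquiv.piFinSuccAbove]
    have hmap : (Measure.pi fun _ : Fin (n + 1) => gaussianReal 0 1) =
        ((gaussianReal 0 1).prod (Measure.pi fun _ : Fin n => gaussianReal 0 1)).map T := by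
      rw [hTe]
      exact (measurePreserving_piFinSuccAbove (fun _ => gaussianReal 0 1) 0).symm.map_eq.symm
    have hm := hasExpMoments_of_isGaussian (gaussianReal 0 1)
    rw [hmap]
    refine ⟨(hm.prod ih1).map T,
      (DualTransportInequality.prod hm ih1 dualTransportInequality_gaussianReal ih2).map T
        fun x y => ?_⟩
    rw [Fin.sum_univ_succ]
    simp [hT0, hTs]

/-- Dual form of Talagrand's transport inequality for the standard Gaussian measure on `ℝⁿ`. -/
theorem dualTransportInequality_gaussian (n : ℕ) :
    DualTransportInequality (gaussian n) fun x y => ‖x - y‖ ^ 2 / 2 := by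
  have h := (dualTransportInequality_pi_gaussianReal n).2.map
    (PiLp.continuousLinearEquiv 2 ℝ fun _ : Fin n => ℝ).symm.toContinuousLinearMap
    (d := fun x y => ‖x - y‖ ^ 2 / 2) fun x y => by
      rw [EuclideanSpace.norm_sq_eq, Finset.sum_div]
      simp
  rwa [show ⇑(PiLp.continuousLinearEquiv 2 ℝ fun _ : Fin n => ℝ).symm.toContinuousLinearMap =
    WithLp.toLp 2 from rfl, map_pi_eq_stdGaussian] at h

/-! ### Exponential bound by the Gaussian width -/

section SupremumOfAffine

variable {n : ℕ}

lemma lipschitzWith_sup'_inner_sub {ι : Type*} (s : Finset ι) (hs : s.Nonempty)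
    (t : ι → EuclideanSpace ℝ (Fin n)) (b : ι → ℝ) :
    LipschitzWith (∑ i ∈ s, ‖t i‖₊) fun x => s.sup' hs fun i => inner ℝ x (t i) - b i := by
  refine LipschitzWith.of_le_add_mul _ fun x y => Finset.sup'_le _ _ fun i hi => ?_
  have h1 := Finset.le_sup' (fun i => inner ℝ y (t i) - b i) hi
  have h2 := real_inner_le_norm (x - y) (t i)
  rw [inner_sub_left] at h2
  have h3 : ‖t i‖ ≤ ((∑ i ∈ s, ‖t i‖₊ : ℝ≥0) : ℝ) := by
    push_cast
    exact Finset.single_le_sum (f := fun i => ‖t i‖) (fun i _ => norm_nonneg _) hi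
  have h4 : ‖x - y‖ * ‖t i‖ ≤ ((∑ i ∈ s, ‖t i‖₊ : ℝ≥0) : ℝ) * dist x y := by
    rw [dist_eq_norm, mul_comm]; gcongr
  linarith

/-- Exponential form of the comparison between the tilted supremum and the Gaussian width, for
finite sets. -/
lemma integral_exp_sup'_le_exp_gaussianWidth {K : Set (EuclideanSpace ℝ (Fin n))}
    (hK : HasGaussianWidth K) {ι : Type*} (s : Finset ι) (hs : s.Nonempty)
    (t : ι → EuclideanSpace ℝ (Fin n)) (ht : ∀ i, t i ∈ K) :
    Integrable (fun x => Real.exp (s.sup' hs fun i => inner ℝ x (t i) - ‖t i‖ ^ 2 / 2))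
      (gaussian n) ∧
    ∫ x, Real.exp (s.sup' hs fun i => inner ℝ x (t i) - ‖t i‖ ^ 2 / 2) ∂(gaussian n) ≤
      Real.exp (gaussianWidth K) := by
  have hm := hasExpMoments_of_isGaussian (gaussian n)
  have hG := lipschitzWith_sup'_inner_sub s hs t fun i => ‖t i‖ ^ 2 / 2
  -- The Lipschitz constant does not depend on the offsets, so both functions share the one K that
  -- the transport inequality asks for.
  have hH := lipschitzWith_sup'_inner_sub s hs t fun _ => 0
  refine ⟨hm.integrable_exp hG, (dualTransportInequality_gaussian n _ _ _ hG hH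
    fun x y => Finset.sup'_le _ _ fun i hi => ?_).trans (Real.exp_le_exp.2 ?_)⟩
  · have h1 := Finset.le_sup' (fun i => inner ℝ y (t i) - (0 : ℝ)) hi
    have h2 : 0 ≤ ‖x - y - t i‖ ^ 2 := by positivity
    rw [norm_sub_sq_real, inner_sub_left] at h2
    simp only at h1 ⊢
    linarith
  · refine integral_mono_ae (hm.integrable hH) hK.2 ?_
    filter_upwards [hK.1] with y hy
    refine Finset.sup'_le _ _ fun i _ => ?_
    rw [sub_zero]
    exact le_csSup hy ⟨t i, ht i, rfl⟩

/-- Finite maxima over V at a dense sequence increase to a supremum that, by continuity of V,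
dominates the integrand. Monotone convergence then passes the finite bound to the limit. -/
theorem lintegral_exp_inner_sub_le_exp_gaussianWidth
    {V : EuclideanSpace ℝ (Fin n) → EuclideanSpace ℝ (Fin n)} (hV : Continuous V)
    (hK : HasGaussianWidth (range V)) :
    ∫⁻ x, ENNReal.ofReal (Real.exp (inner ℝ x (V x) - ‖V x‖ ^ 2 / 2)) ∂(gaussian n) ≤
      ENNReal.ofReal (Real.exp (gaussianWidth (range V))) := by
  let q := TopologicalSpace.denseSeq (EuclideanSpace ℝ (Fin n))
  let G : ℕ → EuclideanSpace ℝ (Fin n) → ℝ := fun m x =>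
    (Finset.range (m + 1)).sup' Finset.nonempty_range_add_one
      fun i => inner ℝ x (V (q i)) - ‖V (q i)‖ ^ 2 / 2
  have hGc : ∀ m, Continuous (G m) := fun m =>
    (lipschitzWith_sup'_inner_sub _ _ _ fun i => ‖V (q i)‖ ^ 2 / 2).continuous
  calc ∫⁻ x, ENNReal.ofReal (Real.exp (inner ℝ x (V x) - ‖V x‖ ^ 2 / 2)) ∂(gaussian n)
      ≤ ∫⁻ x, ⨆ m, ENNReal.ofReal (Real.exp (G m x)) ∂(gaussian n) := by
        refine lintegral_mono fun x => ?_
        refine (TopologicalSpace.denseRange_denseSeq _).induction_on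
          (p := fun z => ENNReal.ofReal (Real.exp (inner ℝ x (V z) - ‖V z‖ ^ 2 / 2)) ≤
            ⨆ m, ENNReal.ofReal (Real.exp (G m x))) x ?_ fun i => ?_
        · exact isClosed_le (ENNReal.continuous_ofReal.comp (by fun_prop)) continuous_const
        · refine le_iSup_of_le i (ENNReal.ofReal_le_ofReal (Real.exp_le_exp.2 ?_))
          exact Finset.le_sup' (fun i => inner ℝ x (V (q i)) - ‖V (q i)‖ ^ 2 / 2)
            (Finset.self_mem_range_succ i)
    _ = ⨆ m, ∫⁻ x, ENNReal.ofReal (Real.exp (G m x)) ∂(gaussian n) := by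
        refine lintegral_iSup (fun m => by have := hGc m; fun_prop) fun a b hab x => ?_
        refine ENNReal.ofReal_le_ofReal (Real.exp_le_exp.2 (Finset.sup'_mono _ ?_ _))
        exact Finset.range_mono (by omega)
    _ ≤ _ := by
        refine iSup_le fun m => ?_
        have h := integral_exp_sup'_le_exp_gaussianWidth hK (Finset.range (m + 1))
          Finset.nonempty_range_add_one (fun i => V (q i)) fun i => ⟨_, rfl⟩
        rw [← ofReal_integral_eq_lintegral_ofReal h.1 (ae_of_all _ fun x => (Real.exp_pos _).le)]
        exact ENNReal.ofReal_le_ofReal h.2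

end SupremumOfAffine

/-! ### Integration by parts without integrable second derivatives -/

section Divergence

/-- A compactly supported differentiable vector field whose divergence is bounded below by a
continuous function `u`, vanishing outside a box, forces `∫ u ≤ 0`. No integrability of the
divergence is required. -/
theorem integral_nonpos_of_le_divergence {n : ℕ} {W : (Fin (n + 1) → ℝ) → Fin (n + 1) → ℝ}
    {W' : (Fin (n + 1) → ℝ) → (Fin (n + 1) → ℝ) →L[ℝ] (Fin (n + 1) → ℝ)}
    (hW : ∀ x, HasFDerivAt W (W' x) x) {u : (Fin (n + 1) → ℝ) → ℝ} (hu : Continuous u)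
    {R : ℝ} (hR : 0 < R) (hW0 : ∀ x, R ≤ ‖x‖ → W x = 0) (hu0 : ∀ x, R ≤ ‖x‖ → u x = 0)
    (hle : ∀ x, u x ≤ ∑ i, W' x (Pi.single i 1) i) : ∫ x, u x ≤ 0 := by
  let I : BoxIntegral.Box (Fin (n + 1)) := ⟨fun _ => -R, fun _ => R, fun _ => by linarith⟩
  have hdiv := BoxIntegral.hasIntegral_GP_divergence_of_forall_hasDerivWithinAt I W W' ∅
    countable_empty (by simp) fun x _ => (hW x).hasFDerivWithinAt
  have hface : ∀ (i : Fin (n + 1)) (a : ℝ), |a| = R → ∀ x, W (i.insertNth a x) i = 0 := by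
    intro i a ha x
    rw [hW0, Pi.zero_apply]
    have := norm_le_pi_norm (i.insertNth (α := fun _ => ℝ) a x) i
    rw [Fin.insertNth_apply_same, Real.norm_eq_abs, ha] at this
    exact this
  have hup : ∀ i, |I.upper i| = R := fun i => abs_of_pos hR
  have hlo : ∀ i, |I.lower i| = R := fun i => (abs_neg R).trans (abs_of_pos hR)
  simp only [hface _ _ (hup _), hface _ _ (hlo _), BoxIntegral.integral_zero, sub_zero,
    Finset.sum_const_zero] at hdiv
  -- The comparison is made between `GP` box integrals: that of the divergence is 0 because W
  -- vanishes on the faces, and that of the continuous u is its Lebesgue integral.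
  have huI := ContinuousOn.hasBoxIntegral (volume : Measure (Fin (n + 1) → ℝ)) (I := I)
    hu.continuousOn BoxIntegral.IntegrationParams.GP
  have hset : ∫ x in (I : Set (Fin (n + 1) → ℝ)), u x = ∫ x, u x := by
    refine setIntegral_eq_integral_of_forall_compl_eq_zero fun x hx => hu0 x ?_
    by_contra! hlt
    refine hx fun i => ?_
    have := (norm_le_pi_norm x i).trans_lt hlt
    rw [Real.norm_eq_abs, abs_lt] at this
    exact ⟨this.1, this.2.le⟩
  rw [hset] at huI
  have hsub := hdiv.sub huI
  have hnn := BoxIntegral.integral_nonneg (I := I) (l := BoxIntegral.IntegrationParams.GP)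
    (g := (fun x => ∑ i, W' x (Pi.single i 1) i) - u)
    (fun x _ => sub_nonneg.2 (hle x)) volume
  linarith [hnn.trans_eq hsub.integral_eq]

variable {n : ℕ} {f : EuclideanSpace ℝ (Fin n) → ℝ}

lemma laplacian_eq_sum_fderiv (x : EuclideanSpace ℝ (Fin n)) :
    (Δ f) x = ∑ i, fderiv ℝ (fderiv ℝ f) x (EuclideanSpace.single i 1)
      (EuclideanSpace.single i 1) := by
  rw [congrFun (InnerProductSpace.laplacian_eq_iteratedFDeriv_orthonormalBasis f
    (EuclideanSpace.basisFun (Fin n) ℝ)) x]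
  simp [iteratedFDeriv_two_apply]

lemma inner_gradient_eq_sum_fderiv (f η : EuclideanSpace ℝ (Fin n) → ℝ)
    (x : EuclideanSpace ℝ (Fin n)) :
    inner ℝ (∇ η x) (∇ f x) =
      ∑ i, fderiv ℝ η x (EuclideanSpace.single i 1) * fderiv ℝ f x (EuclideanSpace.single i 1) := by
  rw [← (EuclideanSpace.basisFun (Fin n) ℝ).sum_inner_mul_inner]
  refine Finset.sum_congr rfl fun i _ => ?_
  rw [← toDual_gradient (f := f), ← toDual_gradient (f := η), InnerProductSpace.toDual_apply_apply,
    InnerProductSpace.toDual_apply_apply, real_inner_comm _ (∇ f x)]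
  simp

lemma continuous_gradient (hf : Continuous (fderiv ℝ f)) : Continuous (∇ f) :=
  (InnerProductSpace.toDual ℝ _).symm.continuous.comp hf

/-- Weak form of a pointwise lower bound on the Laplacian of a twice differentiable function. -/
theorem integral_mul_add_inner_gradient_nonpos (hf' : Differentiable ℝ (fderiv ℝ f)) {m : ℝ}
    (hm : ∀ x, m ≤ Δ f x) (hm0 : n = 0 → m = 0) {η : EuclideanSpace ℝ (Fin n) → ℝ}
    (hη : ContDiff ℝ 1 η) (hηc : HasCompactSupport η) (hη0 : ∀ x, 0 ≤ η x) :
    ∫ x, (m * η x + inner ℝ (∇ η x) (∇ f x)) ≤ 0 := by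
  have hηf : Continuous (fderiv ℝ η) := hη.continuous_fderiv one_ne_zero
  rcases n with _ | n
  -- The divergence theorem needs positive dimension; on ℝ⁰ the integrand vanishes.
  · simp [hm0 rfl, Subsingleton.elim (∇ f _) 0]
  rw [← (PiLp.volume_preserving_toLp (Fin (n + 1))).integral_comp
    (MeasurableEquiv.toLp 2 (Fin (n + 1) → ℝ)).measurableEmbedding]
  let T : (Fin (n + 1) → ℝ) →L[ℝ] EuclideanSpace ℝ (Fin (n + 1)) :=
    (PiLp.continuousLinearEquiv 2 ℝ fun _ : Fin (n + 1) => ℝ).symm.toContinuousLinearMap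
  have hTc : ∀ x, WithLp.toLp 2 x = T x := fun x => rfl
  have hTs : ∀ i, T (Pi.single i 1) = EuclideanSpace.single i 1 := fun i => by
    rw [← hTc]; rfl
  have hcpt : HasCompactSupport (η ∘ T) := hηc.comp_homeomorph
    (PiLp.continuousLinearEquiv 2 ℝ fun _ : Fin (n + 1) => ℝ).symm.toHomeomorph
  obtain ⟨R, hR, hsub⟩ := hcpt.isCompact.isBounded.subset_ball_lt 0 0
  have hout : ∀ x, R ≤ ‖x‖ → T x ∉ tsupport η := fun x hx hmem => by
    have h1 : x ∈ tsupport (η ∘ T) := by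
      rw [show tsupport (η ∘ T) = T ⁻¹' tsupport η from
        tsupport_comp_eq_preimage η
          (PiLp.continuousLinearEquiv 2 ℝ fun _ : Fin (n + 1) => ℝ).symm.toHomeomorph]
      exact hmem
    have := hsub h1
    rw [mem_ball_zero_iff] at this
    linarith
  have hη1 : ∀ x, R ≤ ‖x‖ → η (T x) = 0 := fun x hx => image_eq_zero_of_notMem_tsupport (hout x hx)
  have hη2 : ∀ x, R ≤ ‖x‖ → fderiv ℝ η (T x) = 0 := fun x hx =>
    image_eq_zero_of_notMem_tsupport fun h => hout x hx (tsupport_fderiv_subset ℝ h)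
  have hηg : ∀ x, R ≤ ‖x‖ → ∇ η (T x) = 0 := fun x hx => by
    rw [gradient, hη2 x hx, map_zero]
  let e : Fin (n + 1) → EuclideanSpace ℝ (Fin (n + 1)) := fun i => EuclideanSpace.single i 1
  let W' : (Fin (n + 1) → ℝ) → (Fin (n + 1) → ℝ) →L[ℝ] (Fin (n + 1) → ℝ) := fun x =>
    ContinuousLinearMap.pi fun i =>
      (η (T x) • ((fderiv ℝ (fderiv ℝ f) (T x)).flip (e i)) +
        (fderiv ℝ f (T x) (e i)) • fderiv ℝ η (T x)).comp T
  refine integral_nonpos_of_le_divergence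
    (W := fun x i => η (T x) * fderiv ℝ f (T x) (e i)) (W' := W')
    (fun x => hasFDerivAt_pi.2 fun i => ?_) ?_ hR
    (fun x hx => by ext i; simp [hη1 x hx]) (fun x hx => ?_) fun x => ?_
  · have h1 : HasFDerivAt η (fderiv ℝ η (T x)) (T x) :=
      (hη.differentiable one_ne_zero _).hasFDerivAt
    have h2 : HasFDerivAt (fun z => fderiv ℝ f z (e i))
        ((fderiv ℝ (fderiv ℝ f) (T x)).flip (e i)) (T x) := by
      simpa using (hf' (T x)).hasFDerivAt.clm_apply (hasFDerivAt_const (e i) (T x))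
    exact (h1.mul h2).comp x T.hasFDerivAt
  · have h1 := continuous_gradient hηf
    have h2 := continuous_gradient hf'.continuous
    have h3 := hη.continuous
    have h4 := T.continuous
    simp only [hTc]
    fun_prop
  · rw [hTc, hη1 x hx, hηg x hx]; simp
  · rw [hTc, inner_gradient_eq_sum_fderiv]
    have : ∑ i, W' x (Pi.single i 1) i = η (T x) * Δ f (T x) + ∑ i,
        fderiv ℝ η (T x) (e i) * fderiv ℝ f (T x) (e i) := by
      rw [laplacian_eq_sum_fderiv, Finset.mul_sum, ← Finset.sum_add_distrib]
      refine Finset.sum_congr rfl fun i _ => ?_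
      simp [W', hTs, e, mul_comm]
    rw [this, mul_comm m]
    gcongr
    · exact hη0 _
    · exact hm _

end Divergence

/-! ### Lebesgue density of the Gaussian measure -/

section Density

lemma pi_gaussianReal_eq_withDensity (n : ℕ) :
    (Measure.pi fun _ : Fin n => gaussianReal 0 1) =
      volume.withDensity fun x => ENNReal.ofReal (∏ i, gaussianPDFReal 0 1 (x i)) := by
  refine Measure.pi_eq fun s hs => ?_
  rw [withDensity_apply _ (MeasurableSet.univ_pi hs), volume_pi, Measure.restrict_pi_pi,
    ← ofReal_integral_eq_lintegral_ofReal]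
  · rw [integral_fintype_prod_eq_prod (f := fun _ => gaussianPDFReal 0 1),
      ENNReal.ofReal_prod_of_nonneg fun i _ => integral_nonneg fun x => gaussianPDFReal_nonneg _ _ _]
    refine Finset.prod_congr rfl fun i _ => ?_
    rw [gaussianReal_apply_eq_integral _ one_ne_zero]
  · exact Integrable.fintype_prod fun i => (integrable_gaussianPDFReal 0 1).restrict
  · exact ae_of_all _ fun x => Finset.prod_nonneg fun i _ => gaussianPDFReal_nonneg _ _ _

/-- Only c > 0 is recorded: a positive factor does not affect the sign of the integral obtained by
parts. -/
lemma exists_gaussian_eq_withDensity (n : ℕ) : ∃ c : ℝ, 0 < c ∧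
    gaussian n = volume.withDensity fun x => ENNReal.ofReal (c * Real.exp (-‖x‖ ^ 2 / 2)) := by
  refine ⟨∏ _i : Fin n, (√(2 * Real.pi))⁻¹, Finset.prod_pos fun _ _ => by positivity, ?_⟩
  rw [gaussian, ← map_pi_eq_stdGaussian, pi_gaussianReal_eq_withDensity,
    ← (PiLp.volume_preserving_toLp (Fin n)).map_eq]
  have hT : MeasurableEmbedding (WithLp.toLp 2 : (Fin n → ℝ) → EuclideanSpace ℝ (Fin n)) :=
    (MeasurableEquiv.toLp 2 (Fin n → ℝ)).measurableEmbedding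
  ext s hs
  rw [Measure.map_apply hT.measurable hs, withDensity_apply _ (hT.measurable hs),
    withDensity_apply _ hs, hT.restrict_map, hT.lintegral_map]
  refine lintegral_congr fun x => ?_
  congr 1
  rw [EuclideanSpace.norm_sq_eq, ← Finset.sum_neg_distrib, Finset.sum_div, Real.exp_sum,
    ← Finset.prod_mul_distrib]
  simp [gaussianPDFReal]

end Density

/-- A sequence of smooth cutoff functions exhausting `E`, with uniformly bounded derivatives. -/
lemma exists_cutoff_sequence (E : Type*) [NormedAddCommGroup E] [InnerProductSpace ℝ E]
    [FiniteDimensional ℝ E] : ∃ (χ : ℕ → E → ℝ) (C : ℝ), (∀ k, ContDiff ℝ 1 (χ k)) ∧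
      (∀ k, HasCompactSupport (χ k)) ∧ (∀ k x, 0 ≤ χ k x) ∧ (∀ k x, χ k x ≤ 1) ∧
      (∀ k x, ‖fderiv ℝ (χ k) x‖ ≤ C) ∧ (∀ x, ∀ᶠ k in atTop, χ k x = 1) ∧
      ∀ x, ∀ᶠ k in atTop, fderiv ℝ (χ k) x = 0 := by
  let b : ContDiffBump (0 : E) := ⟨1, 2, one_pos, one_lt_two⟩
  have hbd : ContDiff ℝ 1 b := b.contDiff
  obtain ⟨C, hC⟩ := (hbd.continuous_fderiv one_ne_zero).bounded_above_of_compact_support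
    (b.hasCompactSupport.fderiv ℝ)
  have ha : ∀ k : ℕ, ((k : ℝ) + 1)⁻¹ ≠ 0 := fun k => by positivity
  have hball : ∀ x : E, ∀ᶠ k : ℕ in atTop, ((k : ℝ) + 1)⁻¹ • x ∈ Metric.ball (0 : E) b.rIn := by
    intro x
    have h1 : Tendsto (fun k : ℕ => ((k : ℝ) + 1)⁻¹) atTop (𝓝 0) := by
      simpa using tendsto_one_div_add_atTop_nhds_zero_nat (𝕜 := ℝ)
    have h2 : Tendsto (fun k : ℕ => ((k : ℝ) + 1)⁻¹ • x) atTop (𝓝 0) := by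
      simpa using h1.smul_const x
    exact h2.eventually (Metric.ball_mem_nhds _ b.rIn_pos)
  have hfd : ∀ (k : ℕ) x, fderiv ℝ (fun x => b (((k : ℝ) + 1)⁻¹ • x)) x =
      ((k : ℝ) + 1)⁻¹ • fderiv ℝ b (((k : ℝ) + 1)⁻¹ • x) := fun k x =>
    fderiv_comp_smul (f := b) _
  refine ⟨fun k x => b (((k : ℝ) + 1)⁻¹ • x), C, fun k => by fun_prop,
    fun k => b.hasCompactSupport.comp_smul (ha k), fun k x => b.nonneg, fun k x => b.le_one,
    fun k x => ?_, fun x => ?_, fun x => ?_⟩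
  · rw [hfd, norm_smul, Real.norm_of_nonneg (by positivity)]
    refine (mul_le_of_le_one_left (norm_nonneg _) (inv_le_one_of_one_le₀ ?_)).trans (hC _)
    linarith [Nat.cast_nonneg (α := ℝ) k]
  · filter_upwards [hball x] with k hk
    exact b.one_of_mem_closedBall (Metric.ball_subset_closedBall hk)
  · filter_upwards [hball x] with k hk
    rw [hfd, (b.eventuallyEq_one_of_mem_ball hk).fderiv_eq, Pi.one_def, fderiv_const_apply,
      smul_zero]

/-! ### Integration by parts against ν and the entropy bound -/

section ReverseLogSobolev

variable {n : ℕ} {f : EuclideanSpace ℝ (Fin n) → ℝ}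

lemma integrable_gaussianDensityMeasure_iff (hf : Continuous f)
    {u : EuclideanSpace ℝ (Fin n) → ℝ} :
    Integrable u (gaussianDensityMeasure f) ↔
      Integrable (fun x => u x * Real.exp (f x)) (gaussian n) := by
  rw [gaussianDensityMeasure, integrable_withDensity_iff (by fun_prop) (by simp)]
  simp [(Real.exp_pos _).le]

lemma integral_gaussianDensityMeasure (hf : Continuous f) (u : EuclideanSpace ℝ (Fin n) → ℝ) :
    ∫ x, u x ∂(gaussianDensityMeasure f) = ∫ x, Real.exp (f x) * u x ∂(gaussian n) := by
  rw [gaussianDensityMeasure, integral_withDensity_eq_integral_toReal_smul (by fun_prop) (by simp)]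
  simp [(Real.exp_pos _).le]

lemma llr_gaussianDensityMeasure (hf : Continuous f) :
    llr (gaussianDensityMeasure f) (gaussian n) =ᵐ[gaussianDensityMeasure f] f := by
  have hac : gaussianDensityMeasure f ≪ gaussian n := withDensity_absolutelyContinuous _ _
  refine hac.ae_le ?_
  filter_upwards [Measure.rnDeriv_withDensity (gaussian n)
    (f := fun x => ENNReal.ofReal (Real.exp (f x))) (by fun_prop)] with x hx
  rw [llr, gaussianDensityMeasure, hx, ENNReal.toReal_ofReal (Real.exp_pos _).le, Real.log_exp]

/-- Integration by parts against a cutoff, under a lower bound on the Laplacian of `f`. -/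
lemma integral_cutoff_nonpos (hf : Differentiable ℝ f) (hf' : Differentiable ℝ (fderiv ℝ f))
    {m : ℝ} (hm : ∀ x, m ≤ Δ f x) (hm0 : n = 0 → m = 0)
    {χ : EuclideanSpace ℝ (Fin n) → ℝ} (hχ : ContDiff ℝ 1 χ) (hχc : HasCompactSupport χ)
    (hχ0 : ∀ x, 0 ≤ χ x) :
    ∫ x, (m * χ x + fderiv ℝ χ x (∇ f x) + χ x * (‖∇ f x‖ ^ 2 - inner ℝ x (∇ f x)))
      ∂(gaussianDensityMeasure f) ≤ 0 := by
  obtain ⟨c, hc, hγ⟩ := exists_gaussian_eq_withDensity n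
  have hfd : ContDiff ℝ 1 f := contDiff_one_iff_fderiv.2 ⟨hf, hf'.continuous⟩
  -- Up to the factor c, this η is the Lebesgue density of χ dν.
  have key := integral_mul_add_inner_gradient_nonpos hf' hm hm0
    (η := fun x => χ x * Real.exp (f x - ‖x‖ ^ 2 / 2))
    (hχ.mul (hfd.sub ((contDiff_norm_sq ℝ).div_const 2)).exp) hχc.mul_right
    (fun x => mul_nonneg (hχ0 x) (Real.exp_pos _).le)
  rw [integral_gaussianDensityMeasure hf.continuous, hγ,
    integral_withDensity_eq_integral_toReal_smul (by fun_prop) (by simp)]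
  refine le_of_eq_of_le ?_ (mul_nonpos_of_nonneg_of_nonpos hc.le key)
  rw [← integral_const_mul]
  refine integral_congr_ae (ae_of_all _ fun x => ?_)
  have hχd : HasFDerivAt χ (fderiv ℝ χ x) x := (hχ.differentiable one_ne_zero x).hasFDerivAt
  have hed : HasFDerivAt (fun x => f x - ‖x‖ ^ 2 / 2) (fderiv ℝ f x - innerSL ℝ x) x := by
    refine (hf x).hasFDerivAt.sub ?_
    refine ((hasStrictFDerivAt_norm_sq x).hasFDerivAt.mul_const (2 : ℝ)⁻¹).congr_fderiv ?_
    ext v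
    simp
  have hd : fderiv ℝ (fun x => χ x * Real.exp (f x - ‖x‖ ^ 2 / 2)) x = _ :=
    (hχd.mul hed.exp).fderiv
  have hgr : inner ℝ (∇ (fun x => χ x * Real.exp (f x - ‖x‖ ^ 2 / 2)) x) (∇ f x) =
      fderiv ℝ (fun x => χ x * Real.exp (f x - ‖x‖ ^ 2 / 2)) x (∇ f x) := by
    rw [← toDual_gradient, InnerProductSpace.toDual_apply_apply]
  have hff : fderiv ℝ f x (∇ f x) = ‖∇ f x‖ ^ 2 := by
    rw [← toDual_gradient, InnerProductSpace.toDual_apply_apply, real_inner_self_eq_norm_sq]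
  have hexp : Real.exp (f x - ‖x‖ ^ 2 / 2) = Real.exp (f x) * Real.exp (-‖x‖ ^ 2 / 2) := by
    rw [← Real.exp_add]; ring_nf
  simp only
  rw [hgr, hd]
  simp only [ENNReal.toReal_ofReal (mul_pos hc (Real.exp_pos (-‖x‖ ^ 2 / 2))).le, smul_eq_mul,
    add_apply, smul_apply, sub_apply, innerSL_apply_apply, hff, hexp]
  ring

/-- The entropy-side comparison: `⟨x, ∇f⟩ - |∇f|²/2` is dominated by an explicit `ν`-integrable
function whose integral is at most the entropy plus the Gaussian width. -/
lemma exists_integrable_majorant (hf : Differentiable ℝ f) (hf' : Continuous (fderiv ℝ f))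
    (hν : IsProbabilityMeasure (gaussianDensityMeasure f))
    (hKL : klDiv (gaussianDensityMeasure f) (gaussian n) ≠ ∞)
    (hD : HasGaussianWidth (range (∇ f))) :
    ∃ B : EuclideanSpace ℝ (Fin n) → ℝ, Integrable B (gaussianDensityMeasure f) ∧
      (∀ x, inner ℝ x (∇ f x) - ‖∇ f x‖ ^ 2 / 2 ≤ B x) ∧
      ∫ x, B x ∂(gaussianDensityMeasure f) ≤
        (klDiv (gaussianDensityMeasure f) (gaussian n)).toReal + gaussianWidth (range (∇ f)) := by
  set w := gaussianWidth (range (∇ f))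
  have hVc : Continuous (∇ f) := continuous_gradient hf'
  have hfc := hf.continuous
  obtain ⟨hac, hllr⟩ := klDiv_ne_top_iff.1 hKL
  have hfi : Integrable f (gaussianDensityMeasure f) :=
    hllr.congr (llr_gaussianDensityMeasure hfc)
  have hKLe : (klDiv (gaussianDensityMeasure f) (gaussian n)).toReal =
      ∫ x, f x ∂(gaussianDensityMeasure f) := by
    rw [toReal_klDiv_of_measure_eq hac (by simp),
      integral_congr_ae (llr_gaussianDensityMeasure hfc)]
  set k : EuclideanSpace ℝ (Fin n) → ℝ := fun x => inner ℝ x (∇ f x) - ‖∇ f x‖ ^ 2 / 2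
  have hkc : Continuous k := by fun_prop
  have hlint := lintegral_exp_inner_sub_le_exp_gaussianWidth hVc hD
  have hki : Integrable (fun x => Real.exp (k x)) (gaussian n) := by
    refine ⟨by fun_prop, ?_⟩
    rw [hasFiniteIntegral_iff_ofReal (ae_of_all _ fun x => (Real.exp_pos _).le)]
    exact hlint.trans_lt ENNReal.ofReal_lt_top
  have hkle : ∫ x, Real.exp (k x) ∂(gaussian n) ≤ Real.exp w := by
    rw [← ofReal_integral_eq_lintegral_ofReal hki (ae_of_all _ fun x => (Real.exp_pos _).le)]
      at hlint
    exact (ENNReal.ofReal_le_ofReal_iff (Real.exp_pos _).le).1 hlint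
  have hexp : ∀ x, Real.exp (f x) * Real.exp (k x - w - f x) = Real.exp (k x) * Real.exp (-w) :=
    fun x => by rw [← Real.exp_add, ← Real.exp_add]; ring_nf
  have hei : Integrable (fun x => Real.exp (k x - w - f x)) (gaussianDensityMeasure f) := by
    rw [integrable_gaussianDensityMeasure_iff hfc]
    simp only [mul_comm _ (Real.exp (f _)), hexp]
    exact hki.mul_const _
  have hele : ∫ x, Real.exp (k x - w - f x) ∂(gaussianDensityMeasure f) ≤ 1 := by
    rw [integral_gaussianDensityMeasure hfc]
    simp only [hexp]
    rw [integral_mul_const]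
    calc _ ≤ Real.exp w * Real.exp (-w) := by gcongr
      _ = 1 := by rw [← Real.exp_add]; simp
  -- The majorant comes from a + 1 ≤ e^a with a = k − w − f. The ν-integral of e^a is e^{−w} ∫ e^k
  -- dγ ≤ 1, which cancels the −1.
  refine ⟨fun x => f x + (w - 1) + Real.exp (k x - w - f x),
    (hfi.add (integrable_const _)).add hei, fun x => ?_, ?_⟩
  · have := Real.add_one_le_exp (k x - w - f x)
    change k x ≤ f x + (w - 1) + Real.exp (k x - w - f x)
    linarith
  · have hfi' : Integrable (fun x => f x + (w - 1)) (gaussianDensityMeasure f) :=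
      hfi.add (integrable_const _)
    rw [integral_add hfi' hei, integral_add hfi (integrable_const _),
      integral_const, probReal_univ, one_smul, hKLe]
    linarith

end ReverseLogSobolev

/-! ### Removal of the cutoffs -/

theorem theorem1 (n : ℕ) (f : EuclideanSpace ℝ (Fin n) → ℝ)
    -- `f` is twice differentiable
    (hf : Differentiable ℝ f) (hf' : Differentiable ℝ (fderiv ℝ f))
    -- `ν` is a probability measure
    (hν : IsProbabilityMeasure (gaussianDensityMeasure f))
    -- relative entropy, Fisher information, `inf Δf` and the Gaussian width are finite
    (hKL : klDiv (gaussianDensityMeasure f) (gaussian n) ≠ ∞)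
    (hI : Integrable (fun x => ‖∇ f x‖ ^ 2) (gaussianDensityMeasure f))
    (hM : BddBelow (Set.range (Δ f)))
    (hD : HasGaussianWidth (Set.range (∇ f))) :
    (1 / 2 : ℝ) * fisherInfo f ≤
      (klDiv (gaussianDensityMeasure f) (gaussian n)).toReal + (-⨅ x, Δ f x)
        + gaussianWidth (Set.range (∇ f)) := by
  obtain ⟨B, hBi, hkB, hB⟩ := exists_integrable_majorant hf hf'.continuous hν hKL hD
  obtain ⟨χ, C, hχd, hχc, hχ0, hχ1, hχC, hχlim, hχlim'⟩ :=
    exists_cutoff_sequence (EuclideanSpace ℝ (Fin n))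
  set m : ℝ := ⨅ x, Δ f x
  have hm : ∀ x, m ≤ Δ f x := fun x => ciInf_le hM x
  have hm0 : n = 0 → m = 0 := by
    rintro rfl
    simp [m, laplacian_eq_sum_fderiv]
  have hVc : Continuous (∇ f) := continuous_gradient hf'.continuous
  have hχcont := fun k => (hχd k).continuous
  have hχcont' := fun k => (hχd k).continuous_fderiv one_ne_zero
  have hmeas : ∀ k, AEStronglyMeasurable (fun x => m * χ k x + fderiv ℝ (χ k) x (∇ f x) +
      χ k x * (‖∇ f x‖ ^ 2 / 2 - B x)) (gaussianDensityMeasure f) := fun k => by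
    have h1 := hχcont k
    have h2 := hχcont' k
    have h3 := hBi.aestronglyMeasurable
    have h4 : Continuous fun x => fderiv ℝ (χ k) x (∇ f x) := h2.clm_apply hVc
    exact ((h1.const_mul m).add h4).aestronglyMeasurable.add (h1.aestronglyMeasurable.mul
      (((hVc.norm.pow 2).div_const 2).aestronglyMeasurable.sub h3))
  have hdom : Integrable (fun x => |m| + C * (1 + ‖∇ f x‖ ^ 2) + |‖∇ f x‖ ^ 2 / 2 - B x|)
      (gaussianDensityMeasure f) :=
    ((integrable_const _).add (((integrable_const 1).add hI).const_mul C)).add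
      ((hI.div_const 2).sub hBi).abs
  have hbound : ∀ k x, ‖m * χ k x + fderiv ℝ (χ k) x (∇ f x) +
      χ k x * (‖∇ f x‖ ^ 2 / 2 - B x)‖ ≤
      |m| + C * (1 + ‖∇ f x‖ ^ 2) + |‖∇ f x‖ ^ 2 / 2 - B x| := fun k x => by
    have hC : 0 ≤ C := (norm_nonneg _).trans (hχC 0 0)
    have hχa : |χ k x| ≤ 1 := by rw [abs_of_nonneg (hχ0 k x)]; exact hχ1 k x
    refine (norm_add₃_le).trans ?_
    gcongr
    · rw [norm_mul, Real.norm_eq_abs, Real.norm_eq_abs]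
      exact mul_le_of_le_one_right (abs_nonneg _) hχa
    · refine ((fderiv ℝ (χ k) x).le_of_opNorm_le (hχC k x) _).trans ?_
      gcongr
      nlinarith [sq_nonneg (‖∇ f x‖ - 1), sq_nonneg ‖∇ f x‖]
    · rw [norm_mul, Real.norm_eq_abs, Real.norm_eq_abs]
      exact mul_le_of_le_one_left (abs_nonneg _) hχa
  have hlim : Tendsto (fun k => ∫ x, (m * χ k x + fderiv ℝ (χ k) x (∇ f x) +
      χ k x * (‖∇ f x‖ ^ 2 / 2 - B x)) ∂(gaussianDensityMeasure f)) atTop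
      (𝓝 (∫ x, (m + (‖∇ f x‖ ^ 2 / 2 - B x)) ∂(gaussianDensityMeasure f))) := by
    refine tendsto_integral_of_dominated_convergence _ hmeas hdom
      (fun k => ae_of_all _ (hbound k)) (ae_of_all _ fun x => ?_)
    refine tendsto_const_nhds.congr' ?_
    filter_upwards [hχlim x, hχlim' x] with k h1 h2
    simp [h1, h2]
  have hle : ∀ k, ∫ x, (m * χ k x + fderiv ℝ (χ k) x (∇ f x) +
      χ k x * (‖∇ f x‖ ^ 2 / 2 - B x)) ∂(gaussianDensityMeasure f) ≤ 0 := fun k => by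
    -- Since |∇f|² − ⟨x, ∇f⟩ = |∇f|²/2 − k ≥ |∇f|²/2 − B, the integrand lies below the one from
    -- integration by parts.
    refine le_trans (integral_mono (hdom.mono' (hmeas k) (ae_of_all _ (hbound k))) ?_ fun x => ?_)
      (integral_cutoff_nonpos hf hf' hm hm0 (hχd k) (hχc k) (hχ0 k))
    · refine Continuous.integrable_of_hasCompactSupport ?_ ?_
      · have h1 := hχcont k
        have h4 : Continuous fun x => fderiv ℝ (χ k) x (∇ f x) := (hχcont' k).clm_apply hVc
        fun_prop
      · have h4 : HasCompactSupport fun x => fderiv ℝ (χ k) x (∇ f x) :=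
          ((hχc k).fderiv ℝ).mono fun x hx h => hx (by simp [h])
        exact ((hχc k).mul_left.add h4).add (hχc k).mul_right
    · have := hkB x
      exact add_le_add_right (mul_le_mul_of_nonneg_left (by linarith) (hχ0 k x)) _
  have hfin := le_of_tendsto' hlim hle
  have hsub : Integrable (fun x => ‖∇ f x‖ ^ 2 / 2 - B x) (gaussianDensityMeasure f) :=
    (hI.div_const 2).sub hBi
  rw [integral_add (integrable_const _) hsub,
    integral_sub (hI.div_const 2) hBi, integral_const, probReal_univ, one_smul,
    integral_div] at hfin
  rw [fisherInfo]
  linarith
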